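/- Let $F\in\mathbb R^{m_f\times n}$ have full row rank, $f\in\mathbb R^{m_f}$, $G\in\mathbb R^{m_g\times n}$, $g\in\mathbb R^{m_g}$, and let $k\ge 0$ be an integer. Put $r=n-m_f$. Let $H\in\mathbb R^{n\times r}$ be the trailing $n\times r$ block of the orthogonal factor $Q$ of a QR-decomposition $F^{\mathsf T}=QR$ (so the columns of $H$ form a basis of $\ker F$), and let $x_p\in\mathbb R^n$ satisfy $Fx_p=f$. Define $$D_\Lambda=\left\{\begin{bmatrix}u\\w\end{bmatrix}\in\mathbb R^{k+r}:\ 1-u^{\mathsf T}u\ge 0,\ GHw\le g-Gx_p\right\},$$ where the inequality between vectors is componentwise. For $D\subseteq\mathbb R^N$ let $$\mathscr{FC}_+(D)=\left\{\mathscr A\in\mathbb R^{(N+1)\times(N+1)}\text{ symmetric}:\ \begin{bmatrix}x\\1\end{bmatrix}^{\mathsf T}\mathscr A\begin{bmatrix}x\\1\end{bmatrix}\ge 0\ \text{ for all } x\in D\right\}.$$ Let $p_0=(0,\dots,0,1)^{\mathsf T}\in\mathbb R^{k+r+1}$, and for $i=1,\dots,m_g$ let $p_i^{\mathsf T}$ be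 the $i$-th row of $[\,0\ \ -GH\ \ g-Gx_p\,]\in\mathbb R^{m_g\times(k+r+1)}$. Let $L_{k+1}=\{(\tau,u)\in\mathbb R\times\mathbb R^k:\ \|u\|_2\le\tau\}$, let $\mathcal S_+^{k+r+1}$ be the cone of symmetric positive semidefinite matrices of size $k+r+1$, and let $\operatorname{cone}(S)$ be the set of all finite linear combinations of elements of $S$ with nonnegative coefficients (so $0\in\operatorname{cone}(S)$). Then, with sums of sets taken elementwise, $$\begin{aligned}\mathscr{FC}_+(D_\Lambda)\ \supseteq\ &\mathcal S_+^{k+r+1}+\operatorname{cone}\{\operatorname{diag}(-I_k,0_r,1)\}+\operatorname{cone}\{p_ip_j^{\mathsf T}+p_jp_i^{\mathsf T}:\ i\ne j\in\{0,\dots,m_g\}\}\\&+\sum_{i=0}^{m_g}\left\{p_i\begin{bmatrix}u\\0\\\tau\end{bmatrix}^{\mathsf T}+\begin{bmatrix}u\\0\\\tau\end{bmatrix}p_i^{\mathsf T}:\ (\tau,u)\in L_{k+1}\right\}.\end{aligned}$$ Moreover, if $D_\Lambda\neq\emptyset$ and $m_g\in\{0,1\}$, this inclusion is an equality. -/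

import Mathlib

open scoped Matrix Pointwise

noncomputable section

/-- The vector `[x; 1]` in `ℝ^(ι+1)` attached to a point `x` of `ℝ^ι`. -/
def homVec {ι : Type*} (x : ι → ℝ) : ι ⊕ Unit → ℝ :=
  Sum.elim x (fun _ => 1)

/-- The copositivity cone `FC₊(D)`: the symmetric matrices `A` of size `ι + 1` with
`[x; 1]ᵀ A [x; 1] ≥ 0` for all `x ∈ D`. -/
def copositivityCone {ι : Type*} [Fintype ι] (D : Set (ι → ℝ)) :
    Set (Matrix (ι ⊕ Unit) (ι ⊕ Unit) ℝ) :=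
  {A | A.IsSymm ∧ ∀ x ∈ D, 0 ≤ homVec x ⬝ᵥ (A *ᵥ homVec x)}

/-- The matrix representation `[A b; bᵀ c]` of the quadratic function
`x ↦ xᵀ A x + 2 bᵀ x + c`. -/
def quadMatrix {ι : Type*} (A : Matrix ι ι ℝ) (b : ι → ℝ) (c : ℝ) :
    Matrix (ι ⊕ Unit) (ι ⊕ Unit) ℝ :=
  Matrix.fromBlocks A (Matrix.of fun i _ => b i) (Matrix.of fun _ j => b j)
    (Matrix.of fun _ _ => c)

/-- The quadratic function `q(u, w) = 1 - uᵀ u` on `ℝ^(k+r)`. -/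
def ballQuad (k r : ℕ) (x : Fin k ⊕ Fin r → ℝ) : ℝ :=
  1 - (fun i => x (Sum.inl i)) ⬝ᵥ (fun i => x (Sum.inl i))

/-- The matrix `diag(-I_k, 0_r, 1)` of size `k + r + 1`. -/
def ballMatrix (k r : ℕ) : Matrix ((Fin k ⊕ Fin r) ⊕ Unit) ((Fin k ⊕ Fin r) ⊕ Unit) ℝ :=
  quadMatrix (Matrix.fromBlocks (-1) 0 0 0) 0 1

/-- `diag(-I_k, 0_r, 1)` is the matrix representation of `q(u, w) = 1 - uᵀ u`. -/
theorem homVec_ballMatrix (k r : ℕ) (x : Fin k ⊕ Fin r → ℝ) :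
    homVec x ⬝ᵥ (ballMatrix k r *ᵥ homVec x) = ballQuad k r x := by
  simp [homVec, ballMatrix, quadMatrix, ballQuad, Matrix.mulVec, dotProduct,
    Matrix.one_apply]
  ring

/-- `H` is the trailing `n × (n - m)` block of the orthogonal factor `Q` in a
QR-decomposition `Fᵀ = Q R` (`Q` orthogonal of size `n`, `R` upper triangular of size `n × m`). -/
def IsTrailingQBlock {m n : ℕ} (F : Matrix (Fin m) (Fin n) ℝ)
    (H : Matrix (Fin n) (Fin (n - m)) ℝ) : Prop :=
  ∃ (Q : Matrix (Fin n) (Fin n) ℝ) (R : Matrix (Fin n) (Fin m) ℝ),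
    Q ∈ Matrix.orthogonalGroup (Fin n) ℝ ∧
    (∀ (i : Fin n) (j : Fin m), (j : ℕ) < (i : ℕ) → R i j = 0) ∧
    Fᵀ = Q * R ∧
    ∀ (i : Fin n) (j : Fin (n - m)), H i j = Q i ⟨m + (j : ℕ), by omega⟩

/-- The reduced set `D_Λ = {(u, w) : q(u, w) ≥ 0, G H w ≤ g - G x_p}` in `ℝ^(k+r)`. -/
def reducedSet (k : ℕ) {n r mg : ℕ} (G : Matrix (Fin mg) (Fin n) ℝ) (g : Fin mg → ℝ)
    (H : Matrix (Fin n) (Fin r) ℝ) (xp : Fin n → ℝ) : Set (Fin k ⊕ Fin r → ℝ) :=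
  {x | 0 ≤ ballQuad k r x ∧ (G * H) *ᵥ (fun j => x (Sum.inr j)) ≤ g - G *ᵥ xp}

/-- The vectors `p_0, …, p_{mg}`: `p_0 = [0; 0; 1]`, and `p_{i+1}ᵀ` is the row `i` (counted
from zero) of the matrix `[0, -G H, g - G x_p]`. -/
def pVec (k : ℕ) {n r mg : ℕ} (G : Matrix (Fin mg) (Fin n) ℝ) (g : Fin mg → ℝ)
    (H : Matrix (Fin n) (Fin r) ℝ) (xp : Fin n → ℝ) :
    Fin (mg + 1) → ((Fin k ⊕ Fin r) ⊕ Unit → ℝ) :=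
  Fin.cons (Sum.elim 0 (fun _ => 1))
    (fun i => Sum.elim (Sum.elim 0 (fun j => -(G * H) i j)) (fun _ => (g - G *ᵥ xp) i))

/-- The Lorentz cone `L_{k+1}` of the vectors `[τ; u]` with `‖u‖ ≤ τ` (Euclidean norm). -/
def lorentzCone (k : ℕ) : Set (ℝ × (Fin k → ℝ)) :=
  {z | ‖WithLp.toLp 2 z.2‖ ≤ z.1}

/-- The vector `[u; 0; τ]` in `ℝ^(k+r+1)`. -/
def liftVec {k : ℕ} (r : ℕ) (τ : ℝ) (u : Fin k → ℝ) : (Fin k ⊕ Fin r) ⊕ Unit → ℝ :=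
  Sum.elim (Sum.elim u 0) (fun _ => τ)

/-- The symmetrized outer product `p vᵀ + v pᵀ`. -/
def symOuter {κ : Type*} (p v : κ → ℝ) : Matrix κ κ ℝ :=
  Matrix.vecMulVec p v + Matrix.vecMulVec v p

/-- The conic hull of a set: all finite combinations with nonnegative coefficients
(the empty combination, zero, included). -/
def coneHull {E : Type*} [AddCommGroup E] [Module ℝ E] (S : Set E) : Set E :=
  PointedCone.hull ℝ S

/-- The right-hand side of the approximation: the sum of the cone of positive semidefinite
matrices, the cone of `diag(-I, 0, 1)`, the cone of the `p_i p_jᵀ + p_j p_iᵀ` with `i ≠ j`, and,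
for each `i`, the set of the `p_i [u; 0; τ]ᵀ + [u; 0; τ] p_iᵀ` with `[τ; u] ∈ L_{k+1}`. -/
def innerApprox (k : ℕ) {n r mg : ℕ} (G : Matrix (Fin mg) (Fin n) ℝ) (g : Fin mg → ℝ)
    (H : Matrix (Fin n) (Fin r) ℝ) (xp : Fin n → ℝ) :
    Set (Matrix ((Fin k ⊕ Fin r) ⊕ Unit) ((Fin k ⊕ Fin r) ⊕ Unit) ℝ) :=
  {X | X.PosSemidef} + coneHull {ballMatrix k r}
    + coneHull {X | ∃ i j : Fin (mg + 1), i ≠ j ∧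
        X = symOuter (pVec k G g H xp i) (pVec k G g H xp j)}
    + ∑ i : Fin (mg + 1), {X | ∃ (τ : ℝ) (u : Fin k → ℝ), (τ, u) ∈ lorentzCone k ∧
        X = symOuter (pVec k G g H xp i) (liftVec r τ u)}

end

/-! The inclusion holds because every generator is, on the slice `[x; 1]`, a nonnegative form or a
product of two functions that are nonnegative on the reduced set.

For equality with at most one inequality, a single `p = p_i` with a Slater point on the axis of the
cylinder suffices (`exists_slater_pVec`). Copositivity then means `xᵀ A x ≥ 0` for all `x` with `‖u‖
≤ t` and `p · x ≥ 0`. Slater's condition makes the cone of certificates closed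
(`isClosed_certificateCone`), so a matrix `A` outside it is separated from it by some `X`, which is
positive semidefinite with `tr(JX) ≥ 0` and `X p` in the Lorentz cone, where `J = diag(-I, 0, 1)`.

The contradiction is `tr(AX) ≥ 0` (`trace_mul_nonneg`). If `pᵀ X p > 0`, write `X = z zᵀ + Y` with
`z` a positive multiple of `X p` and `Y p = 0`; otherwise `X p = 0`, and `Y = X` alone remains. By
Dines' theorem on the hyperplane orthogonal to `p`, `Y` has the same traces against `J` and `A` as a
single `y yᵀ` with `p · y = 0`. A rotation in the plane of `z` and `y` then moves both vectors into
the cone where `A` is nonnegative (`quadratic_add_nonneg`). -/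

/-! ### Joint range of two quadratic forms (Dines). -/

theorem Matrix.IsSymm.dotProduct_mulVec_comm {κ : Type*} [Fintype κ] {A : Matrix κ κ ℝ}
    (hA : A.IsSymm) (x y : κ → ℝ) : y ⬝ᵥ (A *ᵥ x) = x ⬝ᵥ (A *ᵥ y) := by
  rw [Matrix.dotProduct_mulVec, ← Matrix.mulVec_transpose, hA.eq, dotProduct_comm]

theorem Matrix.IsSymm.dotProduct_mulVec_add_smul {κ : Type*} [Fintype κ] {A : Matrix κ κ ℝ}
    (hA : A.IsSymm) (x y : κ → ℝ) (a b : ℝ) :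
    (a • x + b • y) ⬝ᵥ (A *ᵥ (a • x + b • y)) =
      a ^ 2 * (x ⬝ᵥ (A *ᵥ x)) + 2 * a * b * (x ⬝ᵥ (A *ᵥ y)) + b ^ 2 * (y ⬝ᵥ (A *ᵥ y)) := by
  simp only [Matrix.mulVec_add, Matrix.mulVec_smul, dotProduct_add, add_dotProduct,
    smul_dotProduct, dotProduct_smul, smul_eq_mul, hA.dotProduct_mulVec_comm x y]
  ring

theorem dotProduct_mulVec_smul_smul {κ : Type*} [Fintype κ] (A : Matrix κ κ ℝ) (x : κ → ℝ)
    (a : ℝ) : (a • x) ⬝ᵥ (A *ᵥ (a • x)) = a ^ 2 * (x ⬝ᵥ (A *ᵥ x)) := by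
  simp only [Matrix.mulVec_smul, smul_dotProduct, dotProduct_smul, smul_eq_mul]
  ring

/-- A traceless binary form takes the opposite values `l` and `-l` at the angles `0` and `π / 2`, so
it vanishes in between. -/
theorem exists_rotation_isotropic (l m : ℝ) :
    ∃ s t : ℝ, s ^ 2 + t ^ 2 = 1 ∧ l * s ^ 2 + 2 * m * s * t - l * t ^ 2 = 0 := by
  let f : ℝ → ℝ := fun θ =>
    l * Real.cos θ ^ 2 + 2 * m * Real.cos θ * Real.sin θ - l * Real.sin θ ^ 2
  have hf : Continuous f := by fun_prop
  have h0 : (0 : ℝ) ∈ Set.uIcc (f 0) (f (Real.pi / 2)) := by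
    simp only [f, Real.cos_zero, Real.sin_zero, Real.cos_pi_div_two, Real.sin_pi_div_two,
      Set.mem_uIcc]
    rcases le_total 0 l with h | h
    · right; constructor <;> linarith
    · left; constructor <;> linarith
  obtain ⟨θ, -, hθ⟩ := intermediate_value_uIcc hf.continuousOn h0
  exact ⟨Real.cos θ, Real.sin θ, by rw [add_comm]; exact Real.sin_sq_add_cos_sq θ, hθ⟩

theorem exists_smul_quadratic_eq {κ : Type*} [Fintype κ] (A J : Matrix κ κ ℝ) (x : κ → ℝ)
    {μ c d : ℝ} (hμ : 0 < μ) (hJ : x ⬝ᵥ (J *ᵥ x) = μ * c) (hA : x ⬝ᵥ (A *ᵥ x) = μ * d) :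
    ∃ a : ℝ, (a • x) ⬝ᵥ (J *ᵥ (a • x)) = c ∧ (a • x) ⬝ᵥ (A *ᵥ (a • x)) = d := by
  refine ⟨(√μ)⁻¹, ?_, ?_⟩ <;>
  · rw [dotProduct_mulVec_smul_smul, inv_pow, Real.sq_sqrt hμ.le]
    first | rw [hJ] | rw [hA]
    field_simp

/-- Dines' theorem: the joint range of two quadratic forms is closed under addition. -/
theorem exists_quadratic_eq_add {κ : Type*} [Fintype κ] {A J : Matrix κ κ ℝ}
    (hA : A.IsSymm) (hJ : J.IsSymm) (V : Submodule ℝ (κ → ℝ)) {x y : κ → ℝ}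
    (hx : x ∈ V) (hy : y ∈ V) :
    ∃ z ∈ V, z ⬝ᵥ (J *ᵥ z) = x ⬝ᵥ (J *ᵥ x) + y ⬝ᵥ (J *ᵥ y) ∧
      z ⬝ᵥ (A *ᵥ z) = x ⬝ᵥ (A *ᵥ x) + y ⬝ᵥ (A *ᵥ y) := by
  set c := x ⬝ᵥ (J *ᵥ x) + y ⬝ᵥ (J *ᵥ y) with hc
  set d := x ⬝ᵥ (A *ᵥ x) + y ⬝ᵥ (A *ᵥ y) with hd
  -- The form `d J - c A` takes opposite values at `x` and `y`, since their sum is `d c - c d`. At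
  -- an isotropic rotated vector the pair of values is parallel to `(c, d)`, and the rotation
  -- preserves the total.
  obtain ⟨s, t, hst, hroot⟩ := exists_rotation_isotropic
    (d * (x ⬝ᵥ (J *ᵥ x)) - c * (x ⬝ᵥ (A *ᵥ x))) (d * (x ⬝ᵥ (J *ᵥ y)) - c * (x ⬝ᵥ (A *ᵥ y)))
  have hJ1 := hJ.dotProduct_mulVec_add_smul x y s t
  have hJ2 := hJ.dotProduct_mulVec_add_smul x y (-t) s
  have hA1 := hA.dotProduct_mulVec_add_smul x y s t
  have hA2 := hA.dotProduct_mulVec_add_smul x y (-t) s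
  have hx' : s • x + t • y ∈ V := V.add_mem (V.smul_mem _ hx) (V.smul_mem _ hy)
  have hy' : -t • x + s • y ∈ V := V.add_mem (V.smul_mem _ hx) (V.smul_mem _ hy)
  generalize s • x + t • y = x' at *
  generalize -t • x + s • y = y' at *
  have hJs : x' ⬝ᵥ (J *ᵥ x') + y' ⬝ᵥ (J *ᵥ y') = c := by
    rw [hJ1, hJ2]; linear_combination c * hst + (s ^ 2 + t ^ 2) * hc.symm
  have hAs : x' ⬝ᵥ (A *ᵥ x') + y' ⬝ᵥ (A *ᵥ y') = d := by
    rw [hA1, hA2]; linear_combination d * hst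
  have hprop : d * (x' ⬝ᵥ (J *ᵥ x')) = c * (x' ⬝ᵥ (A *ᵥ x')) := by
    have h3 : y ⬝ᵥ (J *ᵥ y) = c - x ⬝ᵥ (J *ᵥ x) := by rw [hc]; ring
    have h4 : y ⬝ᵥ (A *ᵥ y) = d - x ⬝ᵥ (A *ᵥ x) := by rw [hd]; ring
    rw [hJ1, hA1, h3, h4]
    linear_combination hroot
  by_cases h0 : c = 0 ∧ d = 0
  · exact ⟨0, V.zero_mem, by simp [h0.1], by simp [h0.2]⟩
  obtain ⟨μ, hμJ, hμA⟩ : ∃ μ : ℝ, x' ⬝ᵥ (J *ᵥ x') = μ * c ∧ x' ⬝ᵥ (A *ᵥ x') = μ * d := by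
    by_cases hc0 : c = 0
    · have hd0 : d ≠ 0 := fun h => h0 ⟨hc0, h⟩
      refine ⟨x' ⬝ᵥ (A *ᵥ x') / d, ?_, by field_simp⟩
      have : d * (x' ⬝ᵥ (J *ᵥ x')) = 0 := by rw [hprop, hc0, zero_mul]
      rw [(mul_eq_zero.1 this).resolve_left hd0, hc0, mul_zero]
    · refine ⟨x' ⬝ᵥ (J *ᵥ x') / c, by field_simp, ?_⟩
      field_simp
      linarith
  -- The rotated vectors have values `μ (c, d)` and `(1 - μ) (c, d)`. One factor is positive, and
  -- rescaling that vector gives `(c, d)`.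
  rcases lt_or_ge 0 μ with hμ | hμ
  · obtain ⟨a, h1, h2⟩ := exists_smul_quadratic_eq A J x' hμ hμJ hμA
    exact ⟨a • x', V.smul_mem _ hx', h1, h2⟩
  · obtain ⟨a, h1, h2⟩ := exists_smul_quadratic_eq A J y' (μ := 1 - μ) (c := c) (d := d)
      (by linarith) (by linarith) (by linarith)
    exact ⟨a • y', V.smul_mem _ hy', h1, h2⟩

theorem exists_quadratic_eq_sum {κ ι : Type*} [Fintype κ] {A J : Matrix κ κ ℝ}
    (hA : A.IsSymm) (hJ : J.IsSymm) (V : Submodule ℝ (κ → ℝ)) (s : Finset ι) {y : ι → κ → ℝ}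
    (hy : ∀ i, y i ∈ V) :
    ∃ z ∈ V, z ⬝ᵥ (J *ᵥ z) = ∑ i ∈ s, y i ⬝ᵥ (J *ᵥ y i) ∧
      z ⬝ᵥ (A *ᵥ z) = ∑ i ∈ s, y i ⬝ᵥ (A *ᵥ y i) := by
  classical
  induction s using Finset.induction_on with
  | empty => exact ⟨0, V.zero_mem, by simp, by simp⟩
  | insert i s hi ih =>
    obtain ⟨z, hz, h1, h2⟩ := ih
    obtain ⟨w, hw, h3, h4⟩ := exists_quadratic_eq_add hA hJ V (hy i) hz
    exact ⟨w, hw, by rw [h3, h1, Finset.sum_insert hi], by rw [h4, h2, Finset.sum_insert hi]⟩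

theorem trace_mul_vecMulVec_self {κ : Type*} [Fintype κ] (A : Matrix κ κ ℝ) (x : κ → ℝ) :
    (A * Matrix.vecMulVec x x).trace = x ⬝ᵥ (A *ᵥ x) := by
  rw [Matrix.mul_vecMulVec, Matrix.trace_vecMulVec, dotProduct_comm]

theorem Matrix.PosSemidef.of_isSymm {κ : Type*} [Fintype κ] {X : Matrix κ κ ℝ} (hs : X.IsSymm)
    (h : ∀ x, 0 ≤ x ⬝ᵥ (X *ᵥ x)) : X.PosSemidef :=
  .of_dotProduct_mulVec_nonneg (by
    rw [Matrix.IsHermitian, Matrix.conjTranspose_eq_transpose_of_trivial]; exact hs)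
    (by simpa using h)

theorem Matrix.PosSemidef.isSymm {κ : Type*} {X : Matrix κ κ ℝ} (hX : X.PosSemidef) :
    X.IsSymm := by
  have := hX.isHermitian
  rwa [Matrix.IsHermitian, Matrix.conjTranspose_eq_transpose_of_trivial] at this

theorem Matrix.PosSemidef.dotProduct_mulVec_self_nonneg {κ : Type*} [Fintype κ]
    {X : Matrix κ κ ℝ} (hX : X.PosSemidef) (x : κ → ℝ) : 0 ≤ x ⬝ᵥ (X *ᵥ x) := by
  simpa using hX.dotProduct_mulVec_nonneg x

/-- The traces of two symmetric matrices against a positive semidefinite `Y` with `Y p = 0` are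
the values of the two quadratic forms at a single vector orthogonal to `p`. -/
theorem exists_quadratic_eq_trace {κ : Type*} [Fintype κ] {A J Y : Matrix κ κ ℝ}
    (hA : A.IsSymm) (hJ : J.IsSymm) (hY : Y.PosSemidef) {p : κ → ℝ} (hp : Y *ᵥ p = 0) :
    ∃ y, p ⬝ᵥ y = 0 ∧ y ⬝ᵥ (J *ᵥ y) = (J * Y).trace ∧ y ⬝ᵥ (A *ᵥ y) = (A * Y).trace := by
  obtain ⟨m, v, hv⟩ := Matrix.posSemidef_iff_eq_sum_vecMulVec.1 hY
  simp only [star_trivial] at hv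
  -- This sum is `pᵀ Y p`, so every rank-one term of `Y` comes from a vector orthogonal to `p`.
  have hsum : ∑ i, (v i ⬝ᵥ p) ^ 2 = 0 := by
    have : p ⬝ᵥ (Y *ᵥ p) = 0 := by rw [hp, dotProduct_zero]
    rw [hv, Matrix.sum_mulVec, dotProduct_sum] at this
    rw [← this]
    refine Finset.sum_congr rfl fun i _ => ?_
    rw [Matrix.vecMulVec_mulVec]
    simp [dotProduct_comm p, sq]
  have hvp : ∀ i, p ⬝ᵥ v i = 0 := fun i => by
    have := (Finset.sum_eq_zero_iff_of_nonneg (fun i _ => sq_nonneg _)).1 hsum i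
      (Finset.mem_univ i)
    rw [dotProduct_comm]
    exact pow_eq_zero_iff two_ne_zero |>.1 this
  let V : Submodule ℝ (κ → ℝ) :=
    { carrier := {y | p ⬝ᵥ y = 0}
      add_mem' := fun {a b} ha hb => by
        simp only [Set.mem_ofPred_eq] at *
        rw [dotProduct_add, ha, hb, add_zero]
      zero_mem' := by simp
      smul_mem' := fun c a ha => by
        simp only [Set.mem_ofPred_eq] at *
        rw [dotProduct_smul, ha, smul_zero] }
  obtain ⟨y, hyV, h1, h2⟩ := exists_quadratic_eq_sum hA hJ V Finset.univ hvp
  refine ⟨y, hyV, ?_, ?_⟩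
  · rw [h1, hv, Finset.mul_sum, Matrix.trace_sum]
    simp only [trace_mul_vecMulVec_self]
  · rw [h2, hv, Finset.mul_sum, Matrix.trace_sum]
    simp only [trace_mul_vecMulVec_self]

/-! ### The Lorentz cone and its self-duality. -/

theorem mem_lorentzCone_iff {k : ℕ} {z : ℝ × (Fin k → ℝ)} :
    z ∈ lorentzCone k ↔ 0 ≤ z.1 ∧ z.2 ⬝ᵥ z.2 ≤ z.1 ^ 2 := by
  have h : ‖WithLp.toLp 2 z.2‖ ^ 2 = z.2 ⬝ᵥ z.2 := by
    rw [EuclideanSpace.real_norm_sq_eq]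
    simp [dotProduct, sq]
  rw [← h]
  constructor
  · intro hz
    have hz' : ‖WithLp.toLp 2 z.2‖ ≤ z.1 := hz
    have := (norm_nonneg _).trans hz'
    exact ⟨this, by gcongr⟩
  · rintro ⟨h0, h1⟩
    exact (le_abs_self _).trans (abs_le_of_sq_le_sq h1 h0)

theorem lorentzCone_zero_mem (k : ℕ) : (0 : ℝ × (Fin k → ℝ)) ∈ lorentzCone k := by
  rw [mem_lorentzCone_iff]; simp

theorem lorentzCone_add_mem {k : ℕ} {z w : ℝ × (Fin k → ℝ)} (hz : z ∈ lorentzCone k)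
    (hw : w ∈ lorentzCone k) : z + w ∈ lorentzCone k := by
  have h1 : ‖WithLp.toLp 2 z.2‖ ≤ z.1 := hz
  have h2 : ‖WithLp.toLp 2 w.2‖ ≤ w.1 := hw
  change ‖WithLp.toLp 2 (z.2 + w.2)‖ ≤ z.1 + w.1
  rw [WithLp.toLp_add]
  exact (norm_add_le _ _).trans (add_le_add h1 h2)

theorem lorentzCone_smul_mem {k : ℕ} {z : ℝ × (Fin k → ℝ)} (hz : z ∈ lorentzCone k)
    {c : ℝ} (hc : 0 ≤ c) : c • z ∈ lorentzCone k := by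
  have h1 : ‖WithLp.toLp 2 z.2‖ ≤ z.1 := hz
  change ‖WithLp.toLp 2 (c • z.2)‖ ≤ c * z.1
  rw [WithLp.toLp_smul, norm_smul, Real.norm_of_nonneg hc]
  gcongr

theorem isClosed_lorentzCone (k : ℕ) : IsClosed (lorentzCone k) := by
  have : lorentzCone k = {z | 0 ≤ z.1} ∩ {z | z.2 ⬝ᵥ z.2 ≤ z.1 ^ 2} := by
    ext z; exact mem_lorentzCone_iff
  rw [this]
  refine (isClosed_le (by fun_prop) (by fun_prop)).inter (isClosed_le ?_ (by fun_prop))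
  simp only [dotProduct]
  fun_prop

theorem lorentzCone_pairing_nonneg {k : ℕ} {z w : ℝ × (Fin k → ℝ)} (hz : z ∈ lorentzCone k)
    (hw : w ∈ lorentzCone k) : 0 ≤ z.2 ⬝ᵥ w.2 + z.1 * w.1 := by
  have h1 : ‖WithLp.toLp 2 z.2‖ ≤ z.1 := hz
  have h2 : ‖WithLp.toLp 2 w.2‖ ≤ w.1 := hw
  have h3 := abs_real_inner_le_norm (WithLp.toLp 2 z.2) (WithLp.toLp 2 w.2)
  have h4 : inner ℝ (WithLp.toLp 2 z.2) (WithLp.toLp 2 w.2) = z.2 ⬝ᵥ w.2 := by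
    simp [PiLp.inner_apply, dotProduct, mul_comm]
  rw [h4] at h3
  have h5 := mul_le_mul h1 h2 (norm_nonneg _) ((norm_nonneg _).trans h1)
  linarith [neg_abs_le (z.2 ⬝ᵥ w.2)]

/-- The Lorentz cone contains its dual. -/
theorem mem_lorentzCone_of_pairing_nonneg {k : ℕ} {z : ℝ × (Fin k → ℝ)}
    (h : ∀ w ∈ lorentzCone k, 0 ≤ w.2 ⬝ᵥ z.2 + w.1 * z.1) : z ∈ lorentzCone k := by
  have h0 : 0 ≤ z.1 := by
    have := h (1, 0) (by rw [mem_lorentzCone_iff]; simp)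
    simpa using this
  set N := ‖WithLp.toLp 2 z.2‖ with hN
  have hsq : N ^ 2 = z.2 ⬝ᵥ z.2 := by
    rw [hN, EuclideanSpace.real_norm_sq_eq]
    simp [dotProduct, sq]
  -- The boundary point `(N, -z.2)` is extremal: pairing with it gives `N² ≤ N z.1`.
  have hN0 : 0 ≤ N := norm_nonneg _
  have h1 := h (N, -z.2) (by
    change ‖WithLp.toLp 2 (-z.2)‖ ≤ N
    rw [WithLp.toLp_neg, norm_neg])
  simp only [neg_dotProduct] at h1
  change N ≤ z.1
  rcases hN0.eq_or_lt with hz | hz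
  · rw [← hz]; exact h0
  · nlinarith

/-- The coordinates `(t, u)` of a vector `(u, w, t)`. -/
def lorentzPart (k r : ℕ) : ((Fin k ⊕ Fin r) ⊕ Unit → ℝ) →ₗ[ℝ] ℝ × (Fin k → ℝ) where
  toFun x := (x (Sum.inr ()), fun i => x (Sum.inl (Sum.inl i)))
  map_add' _ _ := rfl
  map_smul' _ _ := rfl

theorem ballMatrix_isSymm (k r : ℕ) : (ballMatrix k r).IsSymm := by
  ext i j
  rcases i with (i | i) | i <;> rcases j with (j | j) | j <;>
    simp [ballMatrix, quadMatrix, Matrix.one_apply, eq_comm]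

theorem dotProduct_ballMatrix_mulVec (k r : ℕ) (x : (Fin k ⊕ Fin r) ⊕ Unit → ℝ) :
    x ⬝ᵥ (ballMatrix k r *ᵥ x) =
      (lorentzPart k r x).1 ^ 2 - (lorentzPart k r x).2 ⬝ᵥ (lorentzPart k r x).2 := by
  simp [ballMatrix, quadMatrix, lorentzPart, Matrix.mulVec, dotProduct, Matrix.one_apply]
  ring

theorem liftVec_dotProduct {k r : ℕ} (z : ℝ × (Fin k → ℝ)) (x : (Fin k ⊕ Fin r) ⊕ Unit → ℝ) :
    liftVec r z.1 z.2 ⬝ᵥ x =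
      z.2 ⬝ᵥ (lorentzPart k r x).2 + z.1 * (lorentzPart k r x).1 := by
  simp [liftVec, lorentzPart, dotProduct]

theorem lorentzPart_mem_iff {k r : ℕ} {x : (Fin k ⊕ Fin r) ⊕ Unit → ℝ} :
    lorentzPart k r x ∈ lorentzCone k ↔
      0 ≤ (lorentzPart k r x).1 ∧ 0 ≤ x ⬝ᵥ (ballMatrix k r *ᵥ x) := by
  rw [mem_lorentzCone_iff, dotProduct_ballMatrix_mulVec, sub_nonneg]

theorem lorentzPart_mem_or_neg_mem {k r : ℕ} {x : (Fin k ⊕ Fin r) ⊕ Unit → ℝ}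
    (hx : 0 ≤ x ⬝ᵥ (ballMatrix k r *ᵥ x)) :
    lorentzPart k r x ∈ lorentzCone k ∨ lorentzPart k r (-x) ∈ lorentzCone k := by
  rcases le_total 0 (lorentzPart k r x).1 with h | h
  · exact Or.inl (lorentzPart_mem_iff.2 ⟨h, hx⟩)
  · refine Or.inr (lorentzPart_mem_iff.2 ⟨by rw [map_neg]; simpa using h, ?_⟩)
    simpa [Matrix.mulVec_neg] using hx

/-! ### Nonnegativity of the trace pairing. -/

theorem exists_pos_quadratic_root {a b c : ℝ} (ha : a < 0) (hc : 0 < c) :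
    ∃ α : ℝ, 0 < α ∧ c + 2 * α * b + α ^ 2 * a = 0 := by
  have hD : 0 ≤ b ^ 2 - a * c := by nlinarith [sq_nonneg b]
  have hlt : |b| < √(b ^ 2 - a * c) := by
    rw [← Real.sqrt_sq_eq_abs]
    exact Real.sqrt_lt_sqrt (sq_nonneg b) (by nlinarith)
  have hs := Real.sq_sqrt hD
  set R := √(b ^ 2 - a * c)
  refine ⟨(b + R) / (-a), div_pos (by linarith [neg_abs_le b]) (by linarith), ?_⟩
  have ha' : a ≠ 0 := ha.ne
  field_simp
  linear_combination hs

section Decomposition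

variable {k r : ℕ} {A : Matrix ((Fin k ⊕ Fin r) ⊕ Unit) ((Fin k ⊕ Fin r) ⊕ Unit) ℝ}
  {p : (Fin k ⊕ Fin r) ⊕ Unit → ℝ}

theorem quadratic_nonneg_of_orthogonal
    (hAK : ∀ x, lorentzPart k r x ∈ lorentzCone k → 0 ≤ p ⬝ᵥ x → 0 ≤ x ⬝ᵥ (A *ᵥ x))
    {y : (Fin k ⊕ Fin r) ⊕ Unit → ℝ} (hpy : p ⬝ᵥ y = 0)
    (hy : 0 ≤ y ⬝ᵥ (ballMatrix k r *ᵥ y)) : 0 ≤ y ⬝ᵥ (A *ᵥ y) := by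
  rcases lorentzPart_mem_or_neg_mem hy with h | h
  · exact hAK y h hpy.ge
  · have := hAK (-y) h (by simp [hpy])
    simpa [Matrix.mulVec_neg] using this

/-- When `J` is negative at `y`, choose `α > 0` with `J` zero at `z + α y`. The values of any form
at `z + α y` and `α z - y` sum to `1 + α²` times the sum of its values at `z` and `y`. Hence `J` is
nonnegative at `α z - y` too, and it remains to see that both vectors lie in the cone where `A` is
nonnegative. -/
theorem quadratic_add_nonneg (hA : A.IsSymm)
    (hAK : ∀ x, lorentzPart k r x ∈ lorentzCone k → 0 ≤ p ⬝ᵥ x → 0 ≤ x ⬝ᵥ (A *ᵥ x))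
    {y z : (Fin k ⊕ Fin r) ⊕ Unit → ℝ} (hpy : p ⬝ᵥ y = 0)
    (hz : lorentzPart k r z ∈ lorentzCone k) (hpz : 0 ≤ p ⬝ᵥ z)
    (hyz : 0 ≤ z ⬝ᵥ (ballMatrix k r *ᵥ z) + y ⬝ᵥ (ballMatrix k r *ᵥ y)) :
    0 ≤ z ⬝ᵥ (A *ᵥ z) + y ⬝ᵥ (A *ᵥ y) := by
  rcases le_or_gt 0 (y ⬝ᵥ (ballMatrix k r *ᵥ y)) with hy | hy
  · exact add_nonneg (hAK z hz hpz) (quadratic_nonneg_of_orthogonal hAK hpy hy)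
  have hJ := ballMatrix_isSymm k r
  obtain ⟨α, hα, hroot⟩ := exists_pos_quadratic_root (b := z ⬝ᵥ (ballMatrix k r *ᵥ y)) hy
    (show 0 < z ⬝ᵥ (ballMatrix k r *ᵥ z) by linarith)
  have hJ1 := hJ.dotProduct_mulVec_add_smul z y 1 α
  have hJ2 := hJ.dotProduct_mulVec_add_smul z y α (-1)
  have hA1 := hA.dotProduct_mulVec_add_smul z y 1 α
  have hA2 := hA.dotProduct_mulVec_add_smul z y α (-1)
  have hq1 : 0 ≤ ((1 : ℝ) • z + α • y) ⬝ᵥ (ballMatrix k r *ᵥ ((1 : ℝ) • z + α • y)) := by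
    rw [hJ1]; linarith
  have hq2 : 0 ≤ (α • z + (-1 : ℝ) • y) ⬝ᵥ (ballMatrix k r *ᵥ (α • z + (-1 : ℝ) • y)) := by
    rw [hJ2]
    have := mul_nonneg (by positivity : 0 ≤ 1 + α ^ 2) hyz
    linarith
  have hylor : lorentzPart k r y ∉ lorentzCone k := fun h =>
    hy.not_ge (lorentzPart_mem_iff.1 h).2
  have hylor' : lorentzPart k r (-y) ∉ lorentzCone k := fun h =>
    hy.not_ge (by simpa [Matrix.mulVec_neg] using (lorentzPart_mem_iff.1 h).2)
  -- If the negative of either vector were in the Lorentz cone, adding `z` or `α z` would put `-y`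
  -- or `y` there, although `J` is negative at `y`.
  have h1 := (lorentzPart_mem_or_neg_mem hq1).resolve_right fun h => hylor' (by
    have := lorentzCone_smul_mem (lorentzCone_add_mem hz h) (inv_nonneg.2 hα.le)
    rw [← map_add, ← map_smul] at this
    convert this using 2
    ext i
    simp
    field_simp)
  have h2 := (lorentzPart_mem_or_neg_mem hq2).resolve_right fun h => hylor (by
    have := lorentzCone_add_mem (lorentzCone_smul_mem hz hα.le) h
    rw [← map_smul, ← map_add] at this
    convert this using 2
    ext i
    simp)
  have h3 := hAK _ h1 (by simp [dotProduct_add, hpy, hpz])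
  have h4 := hAK _ h2 (by
    simp only [dotProduct_add, dotProduct_smul, hpy, smul_eq_mul, mul_zero, add_zero]
    positivity)
  rw [hA1] at h3
  rw [hA2] at h4
  have : 0 ≤ (1 + α ^ 2) * (z ⬝ᵥ (A *ᵥ z) + y ⬝ᵥ (A *ᵥ y)) := by linarith
  exact nonneg_of_mul_nonneg_right this (by positivity)

/-- The new form at `x` is the minimum over `s` of the form of `X` at `x + s p`, attained at `s =
-(x · X p) / σ`. -/
theorem Matrix.PosSemidef.sub_rankOne {κ : Type*} [Fintype κ] {X : Matrix κ κ ℝ}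
    (hX : X.PosSemidef) {p : κ → ℝ} (hp : 0 < p ⬝ᵥ (X *ᵥ p)) :
    (X - (p ⬝ᵥ (X *ᵥ p))⁻¹ • Matrix.vecMulVec (X *ᵥ p) (X *ᵥ p)).PosSemidef := by
  set σ := p ⬝ᵥ (X *ᵥ p) with hσ
  refine .of_isSymm ?_ fun x => ?_
  · rw [Matrix.IsSymm, Matrix.transpose_sub, Matrix.transpose_smul,
      Matrix.transpose_vecMulVec, hX.isSymm.eq]
  · have h := hX.dotProduct_mulVec_self_nonneg ((1 : ℝ) • x + (-(x ⬝ᵥ (X *ᵥ p)) / σ) • p)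
    rw [hX.isSymm.dotProduct_mulVec_add_smul, ← hσ] at h
    have h2 : x ⬝ᵥ ((X - σ⁻¹ • Matrix.vecMulVec (X *ᵥ p) (X *ᵥ p)) *ᵥ x) =
        x ⬝ᵥ (X *ᵥ x) - σ⁻¹ * (x ⬝ᵥ (X *ᵥ p)) ^ 2 := by
      rw [Matrix.sub_mulVec, dotProduct_sub, Matrix.smul_mulVec, dotProduct_smul,
        Matrix.vecMulVec_mulVec]
      simp [dotProduct_comm (X *ᵥ p) x, sq]
    rw [h2]
    convert h using 1
    field_simp
    ring

/-- A quadratic form that is copositive on the cone `‖u‖ ≤ t`, `0 ≤ p · x` pairs nonnegatively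
with the positive semidefinite `X` that satisfy the corresponding lifted inequalities. -/
theorem trace_mul_nonneg (hA : A.IsSymm)
    (hAK : ∀ x, lorentzPart k r x ∈ lorentzCone k → 0 ≤ p ⬝ᵥ x → 0 ≤ x ⬝ᵥ (A *ᵥ x))
    {X : Matrix ((Fin k ⊕ Fin r) ⊕ Unit) ((Fin k ⊕ Fin r) ⊕ Unit) ℝ} (hX : X.PosSemidef)
    (hJX : 0 ≤ (ballMatrix k r * X).trace) (hXp : lorentzPart k r (X *ᵥ p) ∈ lorentzCone k) :
    0 ≤ (A * X).trace := by
  have hJ := ballMatrix_isSymm k r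
  rcases (hX.dotProduct_mulVec_self_nonneg p).eq_or_lt with hσ | hσ
  · have h0 : X *ᵥ p = 0 := (hX.dotProduct_mulVec_zero_iff p).1 (by simpa using hσ.symm)
    obtain ⟨y, hpy, h1, h2⟩ := exists_quadratic_eq_trace hA hJ hX h0
    rw [← h2]
    exact quadratic_nonneg_of_orthogonal hAK hpy (h1 ▸ hJX)
  · have hY := hX.sub_rankOne hσ
    set σ := p ⬝ᵥ (X *ᵥ p) with hσd
    have hYp : (X - σ⁻¹ • Matrix.vecMulVec (X *ᵥ p) (X *ᵥ p)) *ᵥ p = 0 := by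
      rw [Matrix.sub_mulVec, Matrix.smul_mulVec, Matrix.vecMulVec_mulVec,
        dotProduct_comm (X *ᵥ p) p, ← hσd]
      ext i
      simp
      field_simp
      simp
    obtain ⟨y, hpy, h1, h2⟩ := exists_quadratic_eq_trace hA hJ hY hYp
    -- Here `z = X p / √σ`, so that `z zᵀ` is the rank-one part removed from `X`, and `p · z = √σ`.
    have htr : ∀ M : Matrix ((Fin k ⊕ Fin r) ⊕ Unit) ((Fin k ⊕ Fin r) ⊕ Unit) ℝ,
        (M * X).trace = ((√σ)⁻¹ • (X *ᵥ p)) ⬝ᵥ (M *ᵥ ((√σ)⁻¹ • (X *ᵥ p))) +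
          (M * (X - σ⁻¹ • Matrix.vecMulVec (X *ᵥ p) (X *ᵥ p))).trace := by
      intro M
      rw [Matrix.mul_sub, Matrix.trace_sub, Matrix.mul_smul, Matrix.trace_smul,
        trace_mul_vecMulVec_self, dotProduct_mulVec_smul_smul, inv_pow, Real.sq_sqrt hσ.le,
        smul_eq_mul]
      ring
    rw [htr, ← h2]
    refine quadratic_add_nonneg hA hAK hpy ?_ ?_ ?_
    · rw [map_smul]
      exact lorentzCone_smul_mem hXp (by positivity)
    · rw [dotProduct_smul, smul_eq_mul]
      positivity
    · rw [h1, ← htr]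
      exact hJX

end Decomposition

/-! ### Symmetrized outer products and the closed cone of certificates. -/

theorem symOuter_isSymm {κ : Type*} (p v : κ → ℝ) : (symOuter p v).IsSymm := by
  rw [Matrix.IsSymm, symOuter, Matrix.transpose_add, Matrix.transpose_vecMulVec,
    Matrix.transpose_vecMulVec, add_comm]

theorem dotProduct_symOuter_mulVec {κ : Type*} [Fintype κ] (p v x : κ → ℝ) :
    x ⬝ᵥ (symOuter p v *ᵥ x) = 2 * (p ⬝ᵥ x) * (v ⬝ᵥ x) := by
  rw [symOuter, Matrix.add_mulVec, dotProduct_add, Matrix.vecMulVec_mulVec,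
    Matrix.vecMulVec_mulVec]
  simp [dotProduct_comm x]
  ring

theorem trace_symOuter_mul {κ : Type*} [Fintype κ] {X : Matrix κ κ ℝ} (hX : X.IsSymm)
    (p v : κ → ℝ) : (symOuter p v * X).trace = 2 * (v ⬝ᵥ (X *ᵥ p)) := by
  rw [Matrix.trace_mul_comm, symOuter, Matrix.mul_add, Matrix.trace_add, Matrix.mul_vecMulVec,
    Matrix.mul_vecMulVec, Matrix.trace_vecMulVec, Matrix.trace_vecMulVec,
    dotProduct_comm _ v, dotProduct_comm _ p, hX.dotProduct_mulVec_comm v p]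
  ring

theorem symOuter_add {κ : Type*} (p v w : κ → ℝ) :
    symOuter p (v + w) = symOuter p v + symOuter p w := by
  ext i j; simp [symOuter, Matrix.vecMulVec_apply]; ring

theorem symOuter_smul {κ : Type*} (p v : κ → ℝ) (c : ℝ) :
    symOuter p (c • v) = c • symOuter p v := by
  ext i j; simp [symOuter, Matrix.vecMulVec_apply]; ring

theorem symOuter_zero {κ : Type*} (p : κ → ℝ) : symOuter p 0 = 0 := by
  ext i j; simp [symOuter]

theorem liftVec_zero {k : ℕ} (r : ℕ) : liftVec r 0 (0 : Fin k → ℝ) = 0 := by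
  ext ((i | i) | i) <;> simp [liftVec]

theorem liftVec_add {k : ℕ} (r : ℕ) (z w : ℝ × (Fin k → ℝ)) :
    liftVec r (z + w).1 (z + w).2 = liftVec r z.1 z.2 + liftVec r w.1 w.2 := by
  ext ((i | i) | i) <;> simp [liftVec]

theorem liftVec_smul {k : ℕ} (r : ℕ) (c : ℝ) (z : ℝ × (Fin k → ℝ)) :
    liftVec r (c • z).1 (c • z).2 = c • liftVec r z.1 z.2 := by
  ext ((i | i) | i) <;> simp [liftVec]

theorem isClosed_posSemidef (κ : Type*) [Fintype κ] :
    IsClosed {X : Matrix κ κ ℝ | X.PosSemidef} := by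
  have : {X : Matrix κ κ ℝ | X.PosSemidef} =
      {X | Xᵀ = X} ∩ ⋂ x : κ → ℝ, {X | 0 ≤ x ⬝ᵥ (X *ᵥ x)} := by
    ext X
    simp only [Set.mem_inter_iff, Set.mem_iInter, Set.mem_ofPred_eq]
    exact ⟨fun h => ⟨h.isSymm, h.dotProduct_mulVec_self_nonneg⟩,
      fun h => .of_isSymm h.1 h.2⟩
  rw [this]
  refine (isClosed_eq (by fun_prop) (by fun_prop)).inter (isClosed_iInter fun x => ?_)
  exact isClosed_le continuous_const (by fun_prop)

/-- The residual of `M` after subtracting `l • diag(-I, 0, 1)` and `p vᵀ + v pᵀ`. -/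
def certificateResidual (k r : ℕ) (p : (Fin k ⊕ Fin r) ⊕ Unit → ℝ)
    (M : Matrix ((Fin k ⊕ Fin r) ⊕ Unit) ((Fin k ⊕ Fin r) ⊕ Unit) ℝ)
    (c : ℝ × ℝ × (Fin k → ℝ)) : Matrix ((Fin k ⊕ Fin r) ⊕ Unit) ((Fin k ⊕ Fin r) ⊕ Unit) ℝ :=
  M - c.1 • ballMatrix k r - symOuter p (liftVec r c.2.1 c.2.2)

/-- The matrices that become positive semidefinite after subtracting a nonnegative multiple of
`diag(-I, 0, 1)` and some `p vᵀ + v pᵀ` with `v` lifted from the Lorentz cone. -/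
def certificateCone (k r : ℕ) (p : (Fin k ⊕ Fin r) ⊕ Unit → ℝ) :
    Set (Matrix ((Fin k ⊕ Fin r) ⊕ Unit) ((Fin k ⊕ Fin r) ⊕ Unit) ℝ) :=
  {M | ∃ c : ℝ × ℝ × (Fin k → ℝ), 0 ≤ c.1 ∧ c.2 ∈ lorentzCone k ∧ (certificateResidual k r p M c).PosSemidef}

section Certificate

variable {k r : ℕ} {p : (Fin k ⊕ Fin r) ⊕ Unit → ℝ}

theorem continuous_residual : Continuous fun z :
    Matrix ((Fin k ⊕ Fin r) ⊕ Unit) ((Fin k ⊕ Fin r) ⊕ Unit) ℝ × (ℝ × ℝ × (Fin k → ℝ)) =>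
      certificateResidual k r p z.1 z.2 := by
  have h : Continuous fun z : ℝ × (Fin k → ℝ) => liftVec r z.1 z.2 := by
    refine continuous_pi fun i => ?_
    rcases i with (i | i) | i <;> simp only [liftVec, Sum.elim_inl, Sum.elim_inr] <;> fun_prop
  have h' : Continuous fun z : ℝ × (Fin k → ℝ) => symOuter p (liftVec r z.1 z.2) := by
    simp only [symOuter]
    fun_prop
  simp only [certificateResidual]
  exact (continuous_fst.sub (by fun_prop)).sub (h'.comp (by fun_prop))

theorem certificateCone_add_mem {M N : Matrix ((Fin k ⊕ Fin r) ⊕ Unit) ((Fin k ⊕ Fin r) ⊕ Unit) ℝ}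
    (hM : M ∈ certificateCone k r p) (hN : N ∈ certificateCone k r p) :
    M + N ∈ certificateCone k r p := by
  obtain ⟨c, h1, h2, h3⟩ := hM
  obtain ⟨d, h4, h5, h6⟩ := hN
  refine ⟨c + d, add_nonneg h1 h4, lorentzCone_add_mem h2 h5, ?_⟩
  convert h3.add h6 using 1
  rw [certificateResidual, certificateResidual, certificateResidual,
    show (c + d).2 = c.2 + d.2 from rfl, show (c + d).1 = c.1 + d.1 from rfl, liftVec_add,
    symOuter_add, add_smul]
  abel

theorem certificateCone_smul_mem
    {M : Matrix ((Fin k ⊕ Fin r) ⊕ Unit) ((Fin k ⊕ Fin r) ⊕ Unit) ℝ}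
    (hM : M ∈ certificateCone k r p) {a : ℝ} (ha : 0 ≤ a) : a • M ∈ certificateCone k r p := by
  obtain ⟨c, h1, h2, h3⟩ := hM
  refine ⟨a • c, mul_nonneg ha h1, lorentzCone_smul_mem h2 ha, ?_⟩
  convert h3.smul ha using 1
  rw [certificateResidual, certificateResidual, show (a • c).2 = a • c.2 from rfl,
    show (a • c).1 = a • c.1 from rfl, liftVec_smul, symOuter_smul, smul_sub, smul_sub,
    smul_assoc]

theorem posSemidef_mem_certificateCone
    {M : Matrix ((Fin k ⊕ Fin r) ⊕ Unit) ((Fin k ⊕ Fin r) ⊕ Unit) ℝ} (hM : M.PosSemidef) :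
    M ∈ certificateCone k r p :=
  ⟨0, le_rfl, lorentzCone_zero_mem k, by simpa [certificateResidual, liftVec_zero, symOuter_zero] using hM⟩

theorem ballMatrix_mem_certificateCone : ballMatrix k r ∈ certificateCone k r p :=
  ⟨(1, 0), zero_le_one, lorentzCone_zero_mem k, by
    simpa [certificateResidual, liftVec_zero, symOuter_zero] using Matrix.PosSemidef.zero⟩

theorem symOuter_mem_certificateCone {z : ℝ × (Fin k → ℝ)} (hz : z ∈ lorentzCone k) :
    symOuter p (liftVec r z.1 z.2) ∈ certificateCone k r p :=
  ⟨(0, z), le_rfl, hz, by simpa [certificateResidual] using Matrix.PosSemidef.zero⟩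

/-- Under a Slater condition the certificate cone is closed. -/
theorem isClosed_certificateCone {e : (Fin k ⊕ Fin r) ⊕ Unit → ℝ}
    (he : lorentzPart k r e = (1, 0)) (hpe : 0 < p ⬝ᵥ e) :
    IsClosed (certificateCone k r p) := by
  have : FirstCountableTopology
      (Matrix ((Fin k ⊕ Fin r) ⊕ Unit) ((Fin k ⊕ Fin r) ⊕ Unit) ℝ) :=
    inferInstanceAs (FirstCountableTopology
      ((Fin k ⊕ Fin r) ⊕ Unit → (Fin k ⊕ Fin r) ⊕ Unit → ℝ))
  refine IsSeqClosed.isClosed fun M M₀ hM hlim => ?_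
  choose c hc1 hc2 hc3 using hM
  -- Evaluating the residual at the Slater vector `e` bounds both multipliers, because `p · e > 0`;
  -- `u` is bounded by `τ`. A subsequence of the certificates therefore converges.
  have hval : ∀ n, (c n).1 + 2 * (p ⬝ᵥ e) * (c n).2.1 ≤ e ⬝ᵥ (M n *ᵥ e) := fun n => by
    have h := (hc3 n).dotProduct_mulVec_self_nonneg e
    rw [certificateResidual, Matrix.sub_mulVec, Matrix.sub_mulVec, dotProduct_sub, dotProduct_sub,
      dotProduct_symOuter_mulVec, liftVec_dotProduct, he, Matrix.smul_mulVec, dotProduct_smul,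
      dotProduct_ballMatrix_mulVec, he] at h
    simp at h
    linarith
  have hcont : Continuous fun N : Matrix ((Fin k ⊕ Fin r) ⊕ Unit) ((Fin k ⊕ Fin r) ⊕ Unit) ℝ =>
      e ⬝ᵥ (N *ᵥ e) := by fun_prop
  obtain ⟨B, hB⟩ := ((hcont.tendsto M₀).comp hlim).bddAbove_range
  have hB' : ∀ n, e ⬝ᵥ (M n *ᵥ e) ≤ B := fun n => hB ⟨n, rfl⟩
  have hτ : ∀ n, 0 ≤ (c n).2.1 := fun n => (mem_lorentzCone_iff.1 (hc2 n)).1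
  have hball : ∀ n, c n ∈ Metric.closedBall (0 : ℝ × ℝ × (Fin k → ℝ))
      (max B (B / (2 * (p ⬝ᵥ e)))) := fun n => by
    have h1 : (c n).1 ≤ B := by
      have := mul_nonneg (mul_nonneg zero_le_two hpe.le) (hτ n)
      linarith [hval n, hB' n]
    have h2 : (c n).2.1 ≤ B / (2 * (p ⬝ᵥ e)) := by
      rw [le_div_iff₀ (by positivity)]
      linarith [hval n, hB' n, hc1 n]
    have h3 : ‖(c n).2.2‖ ≤ (c n).2.1 := by
      refine (pi_norm_le_iff_of_nonneg (hτ n)).2 fun i => ?_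
      exact (PiLp.norm_apply_le (WithLp.toLp 2 (c n).2.2) i).trans (hc2 n)
    rw [mem_closedBall_zero_iff, Prod.norm_def, Prod.norm_def, Real.norm_of_nonneg (hc1 n),
      Real.norm_of_nonneg (hτ n)]
    exact max_le (h1.trans (le_max_left _ _))
      (max_le (h2.trans (le_max_right _ _)) ((h3.trans h2).trans (le_max_right _ _)))
  obtain ⟨c₀, -, φ, hφ, hc₀⟩ := (isCompact_closedBall _ _).tendsto_subseq hball
  refine ⟨c₀, ?_, ?_, ?_⟩
  · exact ge_of_tendsto' ((continuous_fst.tendsto c₀).comp hc₀) fun n => hc1 _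
  · exact (isClosed_lorentzCone k).mem_of_tendsto ((continuous_snd.tendsto c₀).comp hc₀)
      (Filter.Eventually.of_forall fun n => hc2 _)
  · exact (isClosed_posSemidef _).mem_of_tendsto
      ((continuous_residual.tendsto (M₀, c₀)).comp
        ((hlim.comp hφ.tendsto_atTop).prodMk_nhds hc₀))
      (Filter.Eventually.of_forall fun n => hc3 _)

end Certificate

/-! ### Separation from the cone of certificates. -/

/-- A linear functional on matrices is represented on symmetric matrices by the trace pairing
with a symmetric matrix. -/
theorem exists_isSymm_trace_mul_eq {κ : Type*} [Fintype κ] (l : Matrix κ κ ℝ →ₗ[ℝ] ℝ) :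
    ∃ X : Matrix κ κ ℝ, X.IsSymm ∧ ∀ M : Matrix κ κ ℝ, M.IsSymm → l M = (M * X).trace := by
  classical
  refine ⟨Matrix.of fun i j => (l (Matrix.single i j 1) + l (Matrix.single j i 1)) / 2, ?_,
    fun M hM => ?_⟩
  · ext i j; simp [add_comm]
  · have h1 : l M = ∑ i, ∑ j, M i j * l (Matrix.single i j 1) := by
      conv_lhs => rw [Matrix.matrix_eq_sum_single M]
      simp only [map_sum]
      refine Finset.sum_congr rfl fun i _ => Finset.sum_congr rfl fun j _ => ?_
      rw [← smul_eq_mul, ← map_smul, Matrix.smul_single, smul_eq_mul, mul_one]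
    have h2 : l M = ∑ i, ∑ j, M i j * l (Matrix.single j i 1) := by
      rw [h1, Finset.sum_comm]
      refine Finset.sum_congr rfl fun i _ => Finset.sum_congr rfl fun j _ => ?_
      rw [hM.apply i j]
    have h3 : (M * Matrix.of fun i j =>
        (l (Matrix.single i j 1) + l (Matrix.single j i 1)) / 2).trace =
        ((∑ i, ∑ j, M i j * l (Matrix.single i j 1)) +
          ∑ i, ∑ j, M i j * l (Matrix.single j i 1)) / 2 := by
      simp only [Matrix.trace, Matrix.diag, Matrix.mul_apply, Matrix.of_apply,
        ← Finset.sum_add_distrib, Finset.sum_div]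
      refine Finset.sum_congr rfl fun i _ => Finset.sum_congr rfl fun j _ => ?_
      ring
    rw [h3, ← h1, ← h2]
    ring

instance matrixLocallyConvexSpace (κ : Type*) : LocallyConvexSpace ℝ (Matrix κ κ ℝ) :=
  inferInstanceAs (LocallyConvexSpace ℝ (κ → κ → ℝ))

section Main

variable {k r : ℕ} {p : (Fin k ⊕ Fin r) ⊕ Unit → ℝ}
  {A : Matrix ((Fin k ⊕ Fin r) ⊕ Unit) ((Fin k ⊕ Fin r) ⊕ Unit) ℝ}

theorem mem_certificateCone_of_copositive {e : (Fin k ⊕ Fin r) ⊕ Unit → ℝ}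
    (he : lorentzPart k r e = (1, 0)) (hpe : 0 < p ⬝ᵥ e) (hA : A.IsSymm)
    (hAK : ∀ x, lorentzPart k r x ∈ lorentzCone k → 0 ≤ p ⬝ᵥ x → 0 ≤ x ⬝ᵥ (A *ᵥ x)) :
    A ∈ certificateCone k r p := by
  by_contra hnot
  let C : ProperCone ℝ (Matrix ((Fin k ⊕ Fin r) ⊕ Unit) ((Fin k ⊕ Fin r) ⊕ Unit) ℝ) :=
    { carrier := certificateCone k r p
      add_mem' := certificateCone_add_mem
      zero_mem' := posSemidef_mem_certificateCone .zero
      smul_mem' := fun a _ hM => certificateCone_smul_mem hM a.2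
      isClosed' := isClosed_certificateCone he hpe }
  obtain ⟨l, hl, hlA⟩ := C.hyperplane_separation_point (x₀ := A) hnot
  replace hl : ∀ M ∈ certificateCone k r p, 0 ≤ l M := hl
  obtain ⟨X, hXs, hX⟩ := exists_isSymm_trace_mul_eq l.toLinearMap
  replace hX : ∀ M, M.IsSymm → l M = (M * X).trace := hX
  rw [hX A hA] at hlA
  -- Nonnegativity of `l` on each of the three families of generators gives one of the three
  -- conditions on `X`; the last uses self-duality of the Lorentz cone.
  refine hlA.not_ge (trace_mul_nonneg (p := p) hA hAK ?_ ?_ ?_)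
  · refine .of_isSymm hXs fun x => ?_
    have hx : (Matrix.vecMulVec x x).PosSemidef := by
      simpa using Matrix.posSemidef_vecMulVec_self_star x
    rw [← trace_mul_vecMulVec_self, Matrix.trace_mul_comm, ← hX _ hx.isSymm]
    exact hl _ (posSemidef_mem_certificateCone hx)
  · rw [← hX _ (ballMatrix_isSymm k r)]
    exact hl _ ballMatrix_mem_certificateCone
  · refine mem_lorentzCone_of_pairing_nonneg fun w hw => ?_
    have h := hl _ (symOuter_mem_certificateCone (r := r) (p := p) hw)
    rw [hX _ (symOuter_isSymm _ _), trace_symOuter_mul hXs, liftVec_dotProduct] at h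
    linarith

theorem ballQuad_eq_homVec (x : Fin k ⊕ Fin r → ℝ) :
    ballQuad k r x = homVec x ⬝ᵥ (ballMatrix k r *ᵥ homVec x) :=
  (homVec_ballMatrix k r x).symm

/-- Copositivity on the affine slice `t = 1` extends to the closed cone over it. -/
theorem copositive_of_slice {e : (Fin k ⊕ Fin r) ⊕ Unit → ℝ}
    (he : lorentzPart k r e = (1, 0)) (hpe : 0 < p ⬝ᵥ e)
    (hAD : ∀ x : Fin k ⊕ Fin r → ℝ, 0 ≤ ballQuad k r x → 0 ≤ p ⬝ᵥ homVec x →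
      0 ≤ homVec x ⬝ᵥ (A *ᵥ homVec x)) :
    ∀ x, lorentzPart k r x ∈ lorentzCone k → 0 ≤ p ⬝ᵥ x → 0 ≤ x ⬝ᵥ (A *ᵥ x) := by
  have hpos : ∀ x, lorentzPart k r x ∈ lorentzCone k → 0 ≤ p ⬝ᵥ x → 0 < x (Sum.inr ()) →
      0 ≤ x ⬝ᵥ (A *ᵥ x) := by
    intro x hx hpx ht
    set t := x (Sum.inr ()) with htd
    have hhom : homVec (fun i => t⁻¹ * x (Sum.inl i)) = t⁻¹ • x := by
      ext (i | i)
      · simp [homVec]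
      · simp [homVec, ← htd, ht.ne']
    have h := hAD (fun i => t⁻¹ * x (Sum.inl i))
      (by
        rw [ballQuad_eq_homVec, hhom, dotProduct_mulVec_smul_smul]
        exact mul_nonneg (sq_nonneg _) (lorentzPart_mem_iff.1 hx).2)
      (by rw [hhom, dotProduct_smul]; exact mul_nonneg (inv_nonneg.2 ht.le) hpx)
    rw [hhom, dotProduct_mulVec_smul_smul] at h
    exact nonneg_of_mul_nonneg_right h (by positivity)
  intro x hx hpx
  -- Points with `t = 0` cannot be rescaled to the slice. Moving towards `e` makes `t` positive and
  -- keeps both constraints.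
  have hlim : Filter.Tendsto (fun ε : ℝ => (x + ε • e) ⬝ᵥ (A *ᵥ (x + ε • e)))
      (nhdsWithin 0 (Set.Ioi 0)) (nhds (x ⬝ᵥ (A *ᵥ x))) := by
    have hc : Continuous fun ε : ℝ => (x + ε • e) ⬝ᵥ (A *ᵥ (x + ε • e)) := by fun_prop
    have := hc.tendsto 0
    simp only [zero_smul, add_zero] at this
    exact this.mono_left nhdsWithin_le_nhds
  refine ge_of_tendsto hlim (Filter.eventually_of_mem self_mem_nhdsWithin fun ε hε => ?_)
  have hε' : 0 < ε := hε
  have he1 : lorentzPart k r e ∈ lorentzCone k := by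
    rw [he, mem_lorentzCone_iff]; simp
  refine hpos _ ?_ ?_ ?_
  · rw [map_add, map_smul]
    exact lorentzCone_add_mem hx (lorentzCone_smul_mem he1 hε'.le)
  · rw [dotProduct_add, dotProduct_smul, smul_eq_mul]
    positivity
  · have h1 : 0 ≤ x (Sum.inr ()) := (mem_lorentzCone_iff.1 hx).1
    have h2 : e (Sum.inr ()) = 1 := congrArg Prod.fst he
    simp only [Pi.add_apply, Pi.smul_apply, h2, smul_eq_mul, mul_one]
    linarith

end Main

/-! ### Convex-cone structure of the copositive matrices. -/

section CopositivityCone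

variable {ι : Type*} [Fintype ι] {D : Set (ι → ℝ)}

theorem copositivityCone_zero_mem : (0 : Matrix (ι ⊕ Unit) (ι ⊕ Unit) ℝ) ∈ copositivityCone D :=
  ⟨Matrix.isSymm_zero, fun x _ => by simp⟩

theorem copositivityCone_add_mem {A B : Matrix (ι ⊕ Unit) (ι ⊕ Unit) ℝ}
    (hA : A ∈ copositivityCone D) (hB : B ∈ copositivityCone D) : A + B ∈ copositivityCone D :=
  ⟨hA.1.add hB.1, fun x hx => by
    rw [Matrix.add_mulVec, dotProduct_add]
    exact add_nonneg (hA.2 x hx) (hB.2 x hx)⟩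

theorem copositivityCone_smul_mem {A : Matrix (ι ⊕ Unit) (ι ⊕ Unit) ℝ}
    (hA : A ∈ copositivityCone D) {c : ℝ} (hc : 0 ≤ c) : c • A ∈ copositivityCone D :=
  ⟨hA.1.smul c, fun x hx => by
    rw [Matrix.smul_mulVec, dotProduct_smul]
    exact mul_nonneg hc (hA.2 x hx)⟩

theorem coneHull_subset_copositivityCone {S : Set (Matrix (ι ⊕ Unit) (ι ⊕ Unit) ℝ)}
    (hS : S ⊆ copositivityCone D) : coneHull S ⊆ copositivityCone D := by
  intro A hA
  change A ∈ Submodule.span _ S at hA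
  induction hA using Submodule.span_induction with
  | mem A hA => exact hS hA
  | zero => exact copositivityCone_zero_mem
  | add A B _ _ hA hB => exact copositivityCone_add_mem hA hB
  | smul c A _ hA => exact copositivityCone_smul_mem hA c.2

theorem symOuter_mem_copositivityCone {p v : ι ⊕ Unit → ℝ}
    (hp : ∀ x ∈ D, 0 ≤ p ⬝ᵥ homVec x) (hv : ∀ x ∈ D, 0 ≤ v ⬝ᵥ homVec x) :
    symOuter p v ∈ copositivityCone D :=
  ⟨symOuter_isSymm p v, fun x hx => by
    rw [dotProduct_symOuter_mulVec]
    exact mul_nonneg (mul_nonneg zero_le_two (hp x hx)) (hv x hx)⟩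

end CopositivityCone

/-! ### The reduced set: the inclusion, and equality for at most one inequality. -/

section ReducedSet

variable {k n r mg : ℕ} {G : Matrix (Fin mg) (Fin n) ℝ} {g : Fin mg → ℝ}
  {H : Matrix (Fin n) (Fin r) ℝ} {xp : Fin n → ℝ}

theorem pVec_zero_dotProduct_homVec (x : Fin k ⊕ Fin r → ℝ) :
    pVec k G g H xp 0 ⬝ᵥ homVec x = 1 := by
  simp [pVec, homVec, dotProduct]

theorem pVec_succ_dotProduct_homVec (i : Fin mg) (x : Fin k ⊕ Fin r → ℝ) :
    pVec k G g H xp i.succ ⬝ᵥ homVec x =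
      (g - G *ᵥ xp) i - ((G * H) *ᵥ fun j => x (Sum.inr j)) i := by
  simp only [pVec, Fin.cons_succ, homVec, dotProduct, Fintype.sum_sum_type, Sum.elim_inl,
    Sum.elim_inr, Matrix.mulVec, Pi.zero_apply, zero_mul, Finset.sum_const_zero, zero_add,
    neg_mul, Finset.sum_neg_distrib, Finset.univ_unique, Finset.sum_singleton, mul_one]
  ring

theorem mem_reducedSet_iff {x : Fin k ⊕ Fin r → ℝ} :
    x ∈ reducedSet k G g H xp ↔
      0 ≤ ballQuad k r x ∧ ∀ i, 0 ≤ pVec k G g H xp i ⬝ᵥ homVec x := by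
  simp only [Fin.forall_fin_succ, pVec_zero_dotProduct_homVec, pVec_succ_dotProduct_homVec,
    sub_nonneg, zero_le_one, true_and]
  exact Iff.rfl

theorem lorentzPart_homVec (x : Fin k ⊕ Fin r → ℝ) :
    lorentzPart k r (homVec x) = (1, fun i => x (Sum.inl i)) := rfl

theorem innerApprox_subset_copositivityCone :
    innerApprox k G g H xp ⊆ copositivityCone (reducedSet k G g H xp) := by
  have hp : ∀ i, ∀ x ∈ reducedSet k G g H xp, 0 ≤ pVec k G g H xp i ⬝ᵥ homVec x :=
    fun i x hx => (mem_reducedSet_iff.1 hx).2 i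
  rintro _ ⟨_, ⟨_, ⟨P, hP, J, hJ, rfl⟩, S, hS, rfl⟩, T, hT, rfl⟩
  refine copositivityCone_add_mem (copositivityCone_add_mem (copositivityCone_add_mem ?_ ?_) ?_) ?_
  · exact ⟨hP.isSymm, fun x _ => hP.dotProduct_mulVec_self_nonneg _⟩
  · refine coneHull_subset_copositivityCone ?_ hJ
    rintro _ rfl
    exact ⟨ballMatrix_isSymm k r, fun x hx => by rw [homVec_ballMatrix]; exact hx.1⟩
  · refine coneHull_subset_copositivityCone ?_ hS
    rintro _ ⟨i, j, -, rfl⟩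
    exact symOuter_mem_copositivityCone (hp i) (hp j)
  · obtain ⟨t, ht, rfl⟩ := (Set.mem_finsetSum _ _ _).1 hT
    refine Finset.sum_induction _ (· ∈ copositivityCone (reducedSet k G g H xp))
      (fun _ _ => copositivityCone_add_mem) copositivityCone_zero_mem fun i hi => ?_
    obtain ⟨τ, u, hz, h⟩ := ht hi
    rw [h]
    refine symOuter_mem_copositivityCone (hp i) fun x hx => ?_
    rw [liftVec_dotProduct (τ, u)]
    refine lorentzCone_pairing_nonneg hz (lorentzPart_mem_iff.2 ⟨?_, ?_⟩)
    · rw [lorentzPart_homVec]; exact zero_le_one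
    · rw [homVec_ballMatrix]; exact hx.1

theorem certificateCone_subset_innerApprox (i : Fin (mg + 1)) :
    certificateCone k r (pVec k G g H xp i) ⊆ innerApprox k G g H xp := by
  classical
  rintro A ⟨⟨c, τ, u⟩, hc, hz, hP⟩
  -- No cross term is needed: `p_0` is itself `[u; 0; τ]` with `u = 0`, `τ = 1`, so products with
  -- `p_0` are already Lorentz terms.
  have hA : A = certificateResidual k r (pVec k G g H xp i) A (c, τ, u) + c • ballMatrix k r + 0 +
      symOuter (pVec k G g H xp i) (liftVec r τ u) := by
    simp only [certificateResidual]
    abel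
  rw [hA]
  refine Set.add_mem_add (Set.add_mem_add (Set.add_mem_add hP ?_) ?_) ?_
  · exact Submodule.smul_mem (PointedCone.hull ℝ {ballMatrix k r}) (⟨c, hc⟩ : {c : ℝ // 0 ≤ c})
      (PointedCone.subset_hull rfl)
  · exact Submodule.zero_mem _
  · refine (Set.mem_finsetSum _ _ _).2
      ⟨Pi.single i (symOuter (pVec k G g H xp i) (liftVec r τ u)), fun {j} _ => ?_, by simp⟩
    by_cases hj : j = i
    · subst hj
      rw [Pi.single_eq_same]
      exact ⟨τ, u, hz, rfl⟩
    · rw [Pi.single_eq_of_ne hj]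
      exact ⟨0, 0, lorentzCone_zero_mem k, by rw [liftVec_zero, symOuter_zero]⟩

/-- With at most one inequality, a nonempty reduced set is cut out of the cylinder over the ball
by a single `p_i` that satisfies a Slater condition on the axis of the cylinder. -/
theorem exists_slater_pVec (hne : (reducedSet k G g H xp).Nonempty) (hmg : mg = 0 ∨ mg = 1) :
    ∃ (i : Fin (mg + 1)) (w : Fin r → ℝ),
      0 < pVec k G g H xp i ⬝ᵥ homVec (Sum.elim (0 : Fin k → ℝ) w) ∧
      ∀ x : Fin k ⊕ Fin r → ℝ, 0 ≤ ballQuad k r x → 0 ≤ pVec k G g H xp i ⬝ᵥ homVec x →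
        x ∈ reducedSet k G g H xp := by
  rcases hmg with rfl | rfl
  · refine ⟨0, 0, by rw [pVec_zero_dotProduct_homVec]; exact one_pos, fun x hx h => ?_⟩
    exact mem_reducedSet_iff.2 ⟨hx, fun i => by rwa [Fin.fin_one_eq_zero i]⟩
  by_cases hs : ∃ w : Fin r → ℝ,
      0 < pVec k G g H xp (Fin.succ 0) ⬝ᵥ homVec (Sum.elim (0 : Fin k → ℝ) w)
  · obtain ⟨w, hw⟩ := hs
    refine ⟨Fin.succ 0, w, hw, fun x hx h => mem_reducedSet_iff.2 ⟨hx, ?_⟩⟩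
    refine Fin.forall_fin_succ.2 ⟨by rw [pVec_zero_dotProduct_homVec]; exact zero_le_one, ?_⟩
    intro i
    rwa [Subsingleton.elim i 0]
  · push Not at hs
    obtain ⟨x₀, hx₀⟩ := hne
    have h₀ := (mem_reducedSet_iff.1 hx₀).2 (Fin.succ 0)
    refine ⟨0, 0, by rw [pVec_zero_dotProduct_homVec]; exact one_pos, fun x hx _ =>
      mem_reducedSet_iff.2 ⟨hx, ?_⟩⟩
    refine Fin.forall_fin_succ.2 ⟨by rw [pVec_zero_dotProduct_homVec]; exact zero_le_one, ?_⟩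
    intro i
    rw [Subsingleton.elim i 0]
    -- the affine function is nonpositive, and nonnegative at `x₀`, so it vanishes
    have h := hs ((2 : ℝ) • (fun j => x₀ (Sum.inr j)) - fun j => x (Sum.inr j))
    rw [pVec_succ_dotProduct_homVec] at h h₀ ⊢
    simp only [Sum.elim_inr] at h
    have heta : ∀ v : Fin r → ℝ, (fun j => v j) = v := fun _ => rfl
    rw [heta, Matrix.mulVec_sub, Matrix.mulVec_smul, Pi.sub_apply (_ • _), Pi.smul_apply,
      smul_eq_mul] at h
    have h₁ := hs fun j => x₀ (Sum.inr j)
    rw [pVec_succ_dotProduct_homVec] at h₁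
    simp only [Sum.elim_inr] at h₁
    linarith

theorem copositivityCone_eq_innerApprox (hne : (reducedSet k G g H xp).Nonempty)
    (hmg : mg = 0 ∨ mg = 1) :
    copositivityCone (reducedSet k G g H xp) = innerApprox k G g H xp := by
  refine Set.Subset.antisymm (fun A hA => ?_) innerApprox_subset_copositivityCone
  obtain ⟨i, w, hw, hD⟩ := exists_slater_pVec hne hmg
  have he : lorentzPart k r (homVec (Sum.elim (0 : Fin k → ℝ) w)) = (1, 0) := rfl
  refine certificateCone_subset_innerApprox i
    (mem_certificateCone_of_copositive he hw hA.1 (copositive_of_slice he hw fun x h1 h2 => ?_))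
  exact hA.2 x (hD x h1 h2)

end ReducedSet

theorem theorem5p7 {n mf mg k : ℕ}
    (F : Matrix (Fin mf) (Fin n) ℝ) (f : Fin mf → ℝ)
    (G : Matrix (Fin mg) (Fin n) ℝ) (g : Fin mg → ℝ)
    (hF : LinearIndependent ℝ F.row)
    (H : Matrix (Fin n) (Fin (n - mf)) ℝ) (hH : IsTrailingQBlock F H)
    (xp : Fin n → ℝ) (hxp : F *ᵥ xp = f) :
    innerApprox k G g H xp ⊆ copositivityCone (reducedSet k G g H xp) ∧
    ((reducedSet k G g H xp).Nonempty → mg = 0 ∨ mg = 1 →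
      copositivityCone (reducedSet k G g H xp) = innerApprox k G g H xp) :=
  ⟨innerApprox_subset_copositivityCone, copositivityCone_eq_innerApprox⟩
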